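/- Let $\mathbb{F}_q$ be a finite field with $q$ elements, let $f \in \mathbb{F}_q[x]$ be a monic polynomial, and let $G_f(1)$ be the unitary Cayley graph of the finite ring $R = \mathbb{F}_q[x]/(f)$: its vertices are the elements of $R$, and two distinct elements $u, v$ are adjacent if and only if $u - v$ is a unit of $R$. Let $A$ be the adjacency matrix of $G_f(1)$ and $F(t) = \exp(\mathrm{i} A t)$ its continuous-time quantum walk. We say that $G_f(1)$ has perfect state transfer (PST) if there are distinct vertices $u, v$ and a real number $t > 0$ such that $|F(t)_{uv}| = 1$. Then $G_f(1)$ has PST if and only if both of the following conditions hold: - $q = 2$; - $f = x^a (x+1)^b g$ for some integers $a, b \ge 0$ and some squarefree $g \in \mathbb{F}_q[x]$ with $\gcd(g, x(x+1)) = 1$, $1 \le \max\{a,b\} \le 2$ and $(a,b) \neq (2,2)$. -/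

import Mathlib

open Polynomial

/-- The unitary Cayley graph of a commutative ring `R`: its vertices are the elements of `R`, and two
distinct elements are adjacent when their difference is a unit. (The condition `a ≠ b` only
discards the loop in the case of the zero ring.) -/
def unitaryCayleyGraph (R : Type*) [CommRing R] : SimpleGraph R where
  Adj a b := a ≠ b ∧ IsUnit (a - b)
  symm := ⟨fun a b h => ⟨h.1.symm, by
    have h2 := h.2.neg
    rwa [neg_sub] at h2⟩⟩
  loopless := ⟨fun _ h => h.1 rfl⟩

open Classical in
/-- The continuous-time quantum walk `F(t) = exp(i t A_G)` on a finite graph `G` with adjacency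
matrix `A_G`. -/
noncomputable def quantumWalk {V : Type*} [Fintype V] (G : SimpleGraph V) (t : ℝ) :
    Matrix V V ℂ :=
  NormedSpace.exp ((Complex.I * (t : ℂ)) • G.adjMatrix ℂ)

/-- Perfect state transfer on a finite graph: there are distinct vertices `a`, `b` and a time
`t > 0` such that the entry `F(t)_{ab}` has absolute value `1`. -/
def HasPST {V : Type*} [Fintype V] (G : SimpleGraph V) : Prop :=
  ∃ a b : V, a ≠ b ∧ ∃ t : ℝ, 0 < t ∧ ‖quantumWalk G t a b‖ = 1

/-- A quotient of `F[X]` by a monic polynomial over a finite field `F` is finite. -/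
theorem finite_quotient_of_monic {F : Type*} [Field F] [Finite F] {f : F[X]} (hf : f.Monic) :
    Finite (F[X] ⧸ Ideal.span {f}) := by
  have : Module.Finite F (F[X] ⧸ Ideal.span {f}) := hf.finite_quotient
  exact Module.finite_of_finite F

/-- The fintype structure used to form matrices indexed by `F[X] / (f)`, for `f` monic. -/
noncomputable abbrev fintypeQuotientOfMonic {F : Type*} [Field F] [Finite F] {f : F[X]}
    (hf : f.Monic) : Fintype (F[X] ⧸ Ideal.span {f}) :=
  haveI := finite_quotient_of_monic hf
  Fintype.ofFinite _

/-! Both directions pass through an intermediate condition on `f`: `f = d * e` with `d` squarefree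
and `e` equal to `X` or `X + 1` (`exists_squarefree_mul_iff`). Necessity: if `|F(t)_{ab}| = 1`,
unitarity concentrates row `a` at `b`, so every automorphism fixing `a` fixes `b`. Scalings about
`a` then make every unit fix `b - a`, which forces `q = 2` and a factor `X` or `X + 1` of `f`.
Translation by a nilpotent preserves the rows of `A`, so `b - a` is the only possible nonzero
nilpotent. If `f` is not squarefree, testing this on `rad f` and `X * rad f` leaves `f / rad f`
equal to `X` or `X + 1`. Sufficiency: Möbius inversion writes `A` as a signed sum of commuting ideal
matrices `N` with `N ^ 2 = |I| N`, where `I = (d)` for squarefree `d` dividing `f` and `|I| = 2 ^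
deg (f / d)`. At `t = π / 2` each factor `exp (± i t N)` is a phase times a translation: by `d` if
`deg (f / d) = 1`, by `0` otherwise. The product translates by the sum of those `d`, which is
nonzero modulo `f`. -/

/-! ### Entrywise exponentials of complex matrices. -/

section MatrixExponential

variable {V : Type*} [Fintype V] [DecidableEq V]

theorem Matrix.hasSum_exp_complex (M : Matrix V V ℂ) :
    HasSum (fun n : ℕ => ((n.factorial : ℂ)⁻¹) • M ^ n) (NormedSpace.exp M) := by
  open scoped Matrix.Norms.Operator in
  have h := NormedSpace.exp_series_hasSum_exp' (𝕂 := ℂ) M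
  exact h

theorem Matrix.hasSum_exp_apply (M : Matrix V V ℂ) (u v : V) :
    HasSum (fun n : ℕ => ((n.factorial : ℂ)⁻¹) * (M ^ n) u v) (NormedSpace.exp M u v) :=
  (Pi.hasSum.1 ((Pi.hasSum.1 M.hasSum_exp_complex) u)) v

theorem Matrix.exp_submatrix_apply (M : Matrix V V ℂ) (σ : V ≃ V) (h : M.submatrix σ σ = M)
    (u v : V) : NormedSpace.exp M (σ u) (σ v) = NormedSpace.exp M u v := by
  have hp : ∀ n : ℕ, (M ^ n).submatrix σ σ = M ^ n := by
    intro n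
    induction n with
    | zero => simp
    | succ n ih =>
      rw [pow_succ, ← Matrix.submatrix_mul_equiv (M ^ n) M σ σ σ, ih, h]
  refine (M.hasSum_exp_apply (σ u) (σ v)).unique ?_
  convert M.hasSum_exp_apply u v using 3 with n
  exact congrFun (congrFun (hp n) u) v

/-- Equal rows of `M` give equal rows of every positive power, so only the constant term of the
series survives. -/
theorem Matrix.exp_apply_sub_of_row_eq (M : Matrix V V ℂ) {u u' : V} (h : M u = M u') (v : V) :
    NormedSpace.exp M u v - NormedSpace.exp M u' v =
      (1 : Matrix V V ℂ) u v - (1 : Matrix V V ℂ) u' v := by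
  refine ((M.hasSum_exp_apply u v).sub (M.hasSum_exp_apply u' v)).unique ?_
  have h0 : ∀ n : ℕ, n ≠ 0 → ((n.factorial : ℂ)⁻¹) * (M ^ n) u v -
      ((n.factorial : ℂ)⁻¹) * (M ^ n) u' v = 0 := by
    rintro (_ | n) hn
    · exact absurd rfl hn
    · simp [pow_succ', Matrix.mul_apply, h]
  simpa using hasSum_single 0 h0

/-- The exponential of a multiple of a matrix `N` with `N ^ 2 = m N`. -/
theorem Matrix.exp_smul_of_mul_self {N : Matrix V V ℂ} {m : ℂ} (hm : m ≠ 0)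
    (hN : N * N = m • N) (z : ℂ) :
    NormedSpace.exp (z • N) = 1 + ((Complex.exp (z * m) - 1) / m) • N := by
  have hp : ∀ n : ℕ, N ^ (n + 1) = m ^ n • N := by
    intro n
    induction n with
    | zero => simp
    | succ n ih => rw [pow_succ, ih, Matrix.smul_mul, hN, smul_smul, pow_succ]
  have h1 : HasSum (fun n : ℕ => ((n.factorial : ℂ)⁻¹) * (z * m) ^ n) (Complex.exp (z * m)) := by
    have := NormedSpace.exp_series_hasSum_exp' (𝕂 := ℂ) (z * m)
    rw [← Complex.exp_eq_exp_ℂ] at this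
    simpa using this
  ext u v
  refine ((z • N).hasSum_exp_apply u v).unique ?_
  -- The formula for `N ^ n` fails at `n = 0`, so both series are compared from index 1 on.
  have h2 := ((hasSum_nat_add_iff' 1).2 h1).mul_right (m⁻¹ * N u v)
  rw [← hasSum_nat_add_iff' 1]
  have hf : (fun n : ℕ => (((n + 1).factorial : ℂ)⁻¹) * ((z • N) ^ (n + 1)) u v) =
      fun n : ℕ => (((n + 1).factorial : ℂ)⁻¹) * (z * m) ^ (n + 1) * (m⁻¹ * N u v) := by
    ext n
    rw [_root_.smul_pow, hp]
    simp only [Matrix.smul_apply, smul_eq_mul]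
    rw [mul_pow, pow_succ m]
    field_simp
  have hs : (1 + ((Complex.exp (z * m) - 1) / m) • N) u v -
      ∑ i ∈ Finset.range 1, ((i.factorial : ℂ)⁻¹) * ((z • N) ^ i) u v =
      (Complex.exp (z * m) - ∑ i ∈ Finset.range 1, ((i.factorial : ℂ)⁻¹) * (z * m) ^ i) *
        (m⁻¹ * N u v) := by
    simp only [Matrix.add_apply, Matrix.smul_apply, Finset.sum_range_one, smul_eq_mul,
      Nat.factorial_zero, Nat.cast_one, inv_one, pow_zero, one_mul, div_eq_mul_inv]
    ring
  rw [hf, hs]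
  exact h2

end MatrixExponential

/-! ### Unitarity and symmetry of the walk. -/

section QuantumWalk

variable {V : Type*} [Fintype V] (G : SimpleGraph V)

theorem quantumWalk_eq_exp [DecidableEq V] [DecidableRel G.Adj] (t : ℝ) :
    quantumWalk G t = NormedSpace.exp ((Complex.I * (t : ℂ)) • G.adjMatrix ℂ) := by
  unfold quantumWalk
  congr!

theorem quantumWalk_automorphism (t : ℝ) (σ : G ≃g G) (u v : V) :
    quantumWalk G t (σ u) (σ v) = quantumWalk G t u v := by
  classical
  rw [quantumWalk_eq_exp]
  refine Matrix.exp_submatrix_apply _ σ.toEquiv ?_ u v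
  ext a b
  have : G.Adj (σ a) (σ b) ↔ G.Adj a b := σ.map_adj_iff
  simp [this]

/-- The exponent is skew-Hermitian, so its exponential is unitary. -/
theorem sum_norm_sq_quantumWalk (t : ℝ) (u : V) :
    ∑ v, ‖quantumWalk G t u v‖ ^ 2 = 1 := by
  classical
  set M : Matrix V V ℂ := (Complex.I * (t : ℂ)) • G.adjMatrix ℂ with hM
  have hstar : M.conjTranspose = -M := by
    ext a b
    by_cases h : G.Adj b a <;> simp [hM, G.adj_comm a b, h]
  have h1 : NormedSpace.exp M * (NormedSpace.exp M).conjTranspose = 1 := by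
    rw [← Matrix.exp_conjTranspose, hstar,
      ← Matrix.exp_add_of_commute _ _ (Commute.refl M).neg_right, add_neg_cancel,
      NormedSpace.exp_zero]
  have h2 := congrFun (congrFun h1 u) u
  rw [Matrix.mul_apply, Matrix.one_apply_eq] at h2
  have h3 : ((∑ v, ‖NormedSpace.exp M u v‖ ^ 2 : ℝ) : ℂ) = 1 := by
    rw [← h2]
    push_cast
    refine Finset.sum_congr rfl fun v _ => ?_
    rw [Matrix.conjTranspose_apply, ← starRingEnd_apply, Complex.mul_conj']
  rw [quantumWalk_eq_exp]
  exact Complex.ofReal_eq_one.1 h3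

theorem quantumWalk_eq_zero {t : ℝ} {a b c : V} (h : ‖quantumWalk G t a b‖ = 1) (hc : c ≠ b) :
    quantumWalk G t a c = 0 := by
  classical
  have h1 := sum_norm_sq_quantumWalk G t a
  rw [← Finset.add_sum_erase _ _ (Finset.mem_univ b), h] at h1
  have h2 : ∑ v ∈ Finset.univ.erase b, ‖quantumWalk G t a v‖ ^ 2 = 0 := by linarith
  rw [Finset.sum_eq_zero_iff_of_nonneg (fun _ _ => by positivity)] at h2
  simpa using h2 c (by simp [hc])

theorem automorphism_fixes_of_norm_quantumWalk {t : ℝ} {a b : V}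
    (h : ‖quantumWalk G t a b‖ = 1) (σ : G ≃g G) (ha : σ a = a) : σ b = b := by
  by_contra hb
  have h1 := quantumWalk_eq_zero G h hb
  have h2 := quantumWalk_automorphism G t σ a b
  rw [ha, h1] at h2
  simp [← h2] at h

end QuantumWalk

/-! ### Constraints on perfect state transfer from units and nilpotents. -/

section Ring

variable {R : Type*} [CommRing R]

theorem unitaryCayleyGraph_adj [Nontrivial R] {a b : R} :
    (unitaryCayleyGraph R).Adj a b ↔ IsUnit (a - b) := by
  refine ⟨fun h => h.2, fun h => ⟨?_, h⟩⟩
  rintro rfl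
  simp at h

/-- The affine map `r ↦ u * r + c` as an automorphism of the unitary Cayley graph. -/
def unitaryCayleyGraphAffine (u : Rˣ) (c : R) : unitaryCayleyGraph R ≃g unitaryCayleyGraph R where
  toEquiv := (Units.mulLeft u).trans (Equiv.addRight c)
  map_rel_iff' := by
    intro a b
    simp only [unitaryCayleyGraph, Equiv.trans_apply, Units.mulLeft_apply, Equiv.coe_addRight,
      add_sub_add_right_eq_sub, ← mul_sub, Units.isUnit_units_mul, ne_eq, add_left_inj,
      Units.mul_right_inj]

theorem unitaryCayleyGraphAffine_apply (u : Rˣ) (c r : R) :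
    unitaryCayleyGraphAffine u c r = u * r + c := rfl

variable [Fintype R]

theorem unit_mul_sub_of_norm_quantumWalk {t : ℝ} {a b : R}
    (h : ‖quantumWalk (unitaryCayleyGraph R) t a b‖ = 1) {u : R} (hu : IsUnit u) :
    u * (b - a) = b - a := by
  obtain ⟨u, rfl⟩ := hu
  -- The map `r ↦ u * (r - a) + a` fixes `a`.
  have := automorphism_fixes_of_norm_quantumWalk _ h
    (unitaryCayleyGraphAffine u (a - u * a)) (by rw [unitaryCayleyGraphAffine_apply]; ring)
  rw [unitaryCayleyGraphAffine_apply] at this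
  linear_combination this

/-- Rows `a` and `a + j` of `A` agree. For any other `j`, the entries of the walk at `(a + j, a +
j)` and `(a, a + j)` both vanish, yet they must differ by 1. -/
theorem nilpotent_of_norm_quantumWalk {t : ℝ} {a b : R} (hab : a ≠ b)
    (h : ‖quantumWalk (unitaryCayleyGraph R) t a b‖ = 1) {j : R} (hj : IsNilpotent j) :
    j = 0 ∨ j = b - a := by
  classical
  have : Nontrivial R := ⟨a, b, hab⟩
  by_contra! hcon
  have hrow : ((Complex.I * (t : ℂ)) • (unitaryCayleyGraph R).adjMatrix ℂ) (a + j) =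
      ((Complex.I * (t : ℂ)) • (unitaryCayleyGraph R).adjMatrix ℂ) a := by
    ext v
    have h1 : IsUnit (a + j - v) ↔ IsUnit (a - v) := by
      constructor
      · intro hu
        have := hj.neg.isUnit_add_left_of_commute hu (Commute.all _ _)
        rwa [show a + j - v + -j = a - v by ring] at this
      · intro hu
        have := hj.isUnit_add_left_of_commute hu (Commute.all _ _)
        rwa [show a - v + j = a + j - v by ring] at this
    simp only [Matrix.smul_apply, SimpleGraph.adjMatrix_apply, unitaryCayleyGraph_adj, h1]
  have h2 := Matrix.exp_apply_sub_of_row_eq _ hrow (a + j)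
  rw [← quantumWalk_eq_exp] at h2
  have h4 := quantumWalk_automorphism _ t (unitaryCayleyGraphAffine (1 : Rˣ) j) a a
  simp only [unitaryCayleyGraphAffine_apply, Units.val_one, one_mul] at h4
  rw [h4, quantumWalk_eq_zero _ h hab,
    quantumWalk_eq_zero _ h (fun e => hcon.2 (by rw [← e]; ring)),
    Matrix.one_apply_eq, Matrix.one_apply_ne (by simpa using hcon.1)] at h2
  simp at h2

end Ring

/-! ### Units and ideals of the quotient; the shape of `f`. -/

section PolynomialQuotient

variable {F : Type*} [Field F]

theorem mk_eq_zero_iff_dvd {f r : F[X]} :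
    Ideal.Quotient.mk (Ideal.span {f}) r = 0 ↔ f ∣ r := by
  rw [Ideal.Quotient.eq_zero_iff_mem, Ideal.mem_span_singleton]

theorem isUnit_mk_iff_isCoprime {f r : F[X]} :
    IsUnit (Ideal.Quotient.mk (Ideal.span {f}) r) ↔ IsCoprime r f := by
  constructor
  · intro h
    obtain ⟨s, hs⟩ := h.exists_right_inv
    obtain ⟨s, rfl⟩ := Ideal.Quotient.mk_surjective s
    rw [← map_mul, ← map_one (Ideal.Quotient.mk _), ← sub_eq_zero, ← map_sub,
      mk_eq_zero_iff_dvd] at hs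
    obtain ⟨k, hk⟩ := hs
    exact ⟨s, -k, by linear_combination hk⟩
  · rintro ⟨a, b, h⟩
    refine IsUnit.of_mul_eq_one (Ideal.Quotient.mk _ a) ?_
    rw [← map_mul, ← map_one (Ideal.Quotient.mk _), ← sub_eq_zero, ← map_sub,
      mk_eq_zero_iff_dvd]
    exact ⟨-b, by linear_combination h⟩

theorem mk_mem_span_mk_iff_dvd {f d r : F[X]} (hd : d ∣ f) :
    Ideal.Quotient.mk (Ideal.span {f}) r ∈ Ideal.span {Ideal.Quotient.mk (Ideal.span {f}) d} ↔
      d ∣ r := by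
  rw [Ideal.mem_span_singleton]
  refine ⟨?_, fun h => map_dvd _ h⟩
  rintro ⟨s, hs⟩
  obtain ⟨s, rfl⟩ := Ideal.Quotient.mk_surjective s
  rw [← map_mul, ← sub_eq_zero, ← map_sub, mk_eq_zero_iff_dvd] at hs
  have := (hd.trans hs).add (Dvd.intro s rfl)
  rwa [sub_add_cancel] at this

theorem irreducible_X_add_one : Irreducible (X + 1 : F[X]) := by
  simpa using irreducible_X_sub_C (-1 : F)

theorem isCoprime_X_X_add_one : IsCoprime (X : F[X]) (X + 1) := ⟨-1, 1, by ring⟩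

theorem exists_squarefree_mul_iff {f : F[X]} :
    (∃ d e : F[X], Squarefree d ∧ f = d * e ∧ (e = X ∨ e = X + 1)) ↔
      ∃ (a b : ℕ) (g : F[X]), f = X ^ a * (X + 1) ^ b * g ∧
        Squarefree g ∧ IsCoprime g (X * (X + 1)) ∧
        1 ≤ max a b ∧ max a b ≤ 2 ∧ (a, b) ≠ (2, 2) := by
  have hXi := irreducible_X (R := F)
  have hYi := irreducible_X_add_one (F := F)
  constructor
  · rintro ⟨d, e, hd, rfl, he⟩
    have key : ∀ l c : F[X], Irreducible l → Squarefree c →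
        ∃ (i : ℕ) (g : F[X]), i ≤ 1 ∧ c = l ^ i * g ∧ IsCoprime g l := by
      intro l c hl hc
      by_cases hdv : l ∣ c
      · obtain ⟨g, rfl⟩ := hdv
        refine ⟨1, g, le_rfl, by ring, ?_⟩
        exact ((squarefree_mul_iff.1 hc).1.isCoprime).symm
      · exact ⟨0, c, by simp, by simp, (hl.coprime_iff_not_dvd.2 hdv).symm⟩
    obtain ⟨i, c, hi, rfl, hc⟩ := key X d hXi hd
    obtain ⟨j, g, hj, rfl, hg⟩ := key (X + 1) c hYi (hd.squarefree_of_dvd ⟨_, mul_comm _ _⟩)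
    have hgs : Squarefree g := hd.squarefree_of_dvd ⟨X ^ i * (X + 1) ^ j, by ring⟩
    have hgc : IsCoprime g (X * (X + 1)) := (hc.of_mul_left_right).mul_right hg
    rcases he with rfl | rfl
    · refine ⟨i + 1, j, g, by ring, hgs, hgc, by omega, by omega, ?_⟩
      simp only [ne_eq, Prod.mk.injEq]
      omega
    · refine ⟨i, j + 1, g, by ring, hgs, hgc, by omega, by omega, ?_⟩
      simp only [ne_eq, Prod.mk.injEq]
      omega
  · rintro ⟨a, b, g, rfl, hg, hc, h1, h2, h3⟩
    simp only [ne_eq, Prod.mk.injEq] at h3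
    have hsq : ∀ i j : ℕ, i ≤ 1 → j ≤ 1 → Squarefree (X ^ i * (X + 1) ^ j * g) := by
      intro i j hi hj
      have hpow : ∀ (l : F[X]) (k : ℕ), Irreducible l → k ≤ 1 → Squarefree (l ^ k) := by
        intro l k hl hk
        interval_cases k
        · simp
        · simpa using hl.squarefree
      rw [squarefree_mul_iff, squarefree_mul_iff]
      refine ⟨IsCoprime.isRelPrime (IsCoprime.mul_left ?_ ?_), ⟨?_, hpow _ _ hXi hi,
        hpow _ _ hYi hj⟩, hg⟩
      · exact (hc.of_mul_right_left.symm).pow_left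
      · exact (hc.of_mul_right_right.symm).pow_left
      · exact isCoprime_X_X_add_one.pow.isRelPrime
    -- Strip one factor from the larger exponent; since `(2, 2)` is excluded, both remaining
    -- exponents are at most 1.
    rcases le_total b a with hba | hba
    · obtain ⟨a, rfl⟩ : ∃ k, a = k + 1 := ⟨a - 1, by omega⟩
      exact ⟨_, X, hsq a b (by omega) (by omega), by ring, Or.inl rfl⟩
    · obtain ⟨b, rfl⟩ : ∃ k, b = k + 1 := ⟨b - 1, by omega⟩
      exact ⟨_, X + 1, hsq a b (by omega) (by omega), by ring, Or.inr rfl⟩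

end PolynomialQuotient

/-! ### Necessity over a finite field. -/

section TwoElements

variable {F : Type*} [Field F] [Fintype F]

theorem eq_zero_or_eq_one_of_card_eq_two (hF : Fintype.card F = 2) (c : F) : c = 0 ∨ c = 1 := by
  have h := FiniteField.pow_card c
  rw [hF] at h
  have : c * (c - 1) = 0 := by linear_combination h
  rcases mul_eq_zero.1 this with h | h
  · exact Or.inl h
  · exact Or.inr (sub_eq_zero.1 h)

theorem monic_of_card_eq_two (hF : Fintype.card F = 2) {p : F[X]} (hp : p ≠ 0) : p.Monic :=
  (eq_zero_or_eq_one_of_card_eq_two hF _).resolve_left (leadingCoeff_ne_zero.2 hp)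

theorem eq_of_associated_of_card_eq_two (hF : Fintype.card F = 2) {p r : F[X]}
    (h : Associated p r) : p = r := by
  by_cases hp : p = 0
  · rw [hp] at h ⊢
    exact (associated_zero_iff_eq_zero _ |>.1 h.symm).symm
  · exact eq_of_monic_of_associated (monic_of_card_eq_two hF hp)
      (monic_of_card_eq_two hF (h.ne_zero_iff.1 hp)) h

theorem eq_X_or_eq_X_add_one (hF : Fintype.card F = 2) {e : F[X]} (he : e.natDegree = 1) :
    e = X ∨ e = X + 1 := by
  have hm : e.Monic := monic_of_card_eq_two hF (by rintro rfl; simp at he)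
  have h := hm.eq_X_add_C he
  rcases eq_zero_or_eq_one_of_card_eq_two hF (e.coeff 0) with h0 | h0
  · left; simpa [h0] using h
  · right; simpa [h0] using h

variable {f : F[X]}

theorem card_eq_two_of_norm_quantumWalk [Fintype (F[X] ⧸ Ideal.span {f})] {t : ℝ}
    {a b : F[X] ⧸ Ideal.span {f}} (hab : a ≠ b)
    (h : ‖quantumWalk (unitaryCayleyGraph (F[X] ⧸ Ideal.span {f})) t a b‖ = 1) :
    Fintype.card F = 2 := by
  classical
  by_contra hF
  obtain ⟨c, hc0, hc1⟩ : ∃ c : F, c ≠ 0 ∧ c ≠ 1 := by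
    by_contra! hcon
    have h1 : (Finset.univ : Finset F) ⊆ {0, 1} := by
      intro c _
      by_cases hc : c = 0
      · simp [hc]
      · simp [hcon c hc]
    have h2 := (Finset.card_le_card h1).trans Finset.card_le_two
    rw [Finset.card_univ] at h2
    have h3 := Fintype.one_lt_card (α := F)
    omega
  have h1 := unit_mul_sub_of_norm_quantumWalk h
    (((IsUnit.mk0 c hc0).map C).map (Ideal.Quotient.mk (Ideal.span {f})))
  -- Both `c` and `1` fix `b - a`, so the unit `c - 1` annihilates it.
  have h2 : IsUnit (Ideal.Quotient.mk (Ideal.span {f}) (C (c - 1))) :=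
    ((IsUnit.mk0 _ (sub_ne_zero.2 hc1)).map C).map _
  apply hab
  rw [← sub_eq_zero, ← neg_eq_zero, neg_sub, ← h2.mul_right_eq_zero]
  simp only [map_sub, map_one]
  linear_combination h1

theorem exists_squarefree_mul_of_norm_quantumWalk (hf : f ≠ 0)
    [Fintype (F[X] ⧸ Ideal.span {f})] {t : ℝ} {a b : F[X] ⧸ Ideal.span {f}} (hab : a ≠ b)
    (h : ‖quantumWalk (unitaryCayleyGraph (F[X] ⧸ Ideal.span {f})) t a b‖ = 1) :
    ∃ d e : F[X], Squarefree d ∧ f = d * e ∧ (e = X ∨ e = X + 1) := by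
  classical
  have hF := card_eq_two_of_norm_quantumWalk hab h
  -- Otherwise `X` and `X + 1` are both units fixing `b - a`, and so their difference 1 annihilates
  -- it.
  have hdvd : X ∣ f ∨ X + 1 ∣ f := by
    by_contra! hcon
    have hX := (irreducible_X (R := F)).coprime_iff_not_dvd.2 hcon.1
    have hX1 := (irreducible_X_add_one (F := F)).coprime_iff_not_dvd.2 hcon.2
    have h1 := unit_mul_sub_of_norm_quantumWalk h (isUnit_mk_iff_isCoprime.2 hX)
    have h2 := unit_mul_sub_of_norm_quantumWalk h (isUnit_mk_iff_isCoprime.2 hX1)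
    simp only [map_add, map_one] at h2
    exact hab (by linear_combination h1 - h2)
  set d := UniqueFactorizationMonoid.radical f with hd
  have hsq : Squarefree d := UniqueFactorizationMonoid.squarefree_radical
  obtain ⟨e, he⟩ : d ∣ f := UniqueFactorizationMonoid.radical_dvd_self
  have hd0 : d ≠ 0 := by rintro h0; simp [h0] at he; exact hf he
  by_cases hfd : f ∣ d
  · have hfsq : Squarefree f := hsq.squarefree_of_dvd hfd
    rcases hdvd with ⟨k, hk⟩ | ⟨k, hk⟩
    · exact ⟨k, X, hfsq.squarefree_of_dvd ⟨X, by rw [hk]; ring⟩, by rw [hk]; ring, Or.inl rfl⟩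
    · exact ⟨k, X + 1, hfsq.squarefree_of_dvd ⟨X + 1, by rw [hk]; ring⟩, by rw [hk]; ring,
        Or.inr rfl⟩
  · have hnil : IsNilpotent (Ideal.Quotient.mk (Ideal.span {f}) d) := by
      obtain ⟨n, hn⟩ := UniqueFactorizationMonoid.exists_dvd_radical_self_pow hf
      exact ⟨n, by rw [← map_pow, mk_eq_zero_iff_dvd]; exact hn⟩
    have h1 := nilpotent_of_norm_quantumWalk hab h hnil
    have h2 := nilpotent_of_norm_quantumWalk hab h
      ((Commute.all (Ideal.Quotient.mk (Ideal.span {f}) X) _).isNilpotent_mul_left hnil)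
    rw [mk_eq_zero_iff_dvd] at h1
    have h1 := h1.resolve_left hfd
    have heu : ¬ IsUnit e := fun hu => hfd (he ▸ (hu.dvd_mul_right.1 dvd_rfl))
    refine ⟨d, e, hsq, he, ?_⟩
    rw [← map_mul, mk_eq_zero_iff_dvd, ← h1, ← sub_eq_zero (b := Ideal.Quotient.mk _ d),
      ← map_sub, mk_eq_zero_iff_dvd] at h2
    have aux : ∀ l : F[X], Irreducible l → f ∣ d * l → e = l := by
      intro l hl hdl
      rw [he] at hdl
      have h3 := (mul_dvd_mul_iff_left hd0).1 hdl
      exact eq_of_associated_of_card_eq_two hF ((hl.dvd_iff.1 h3).resolve_left heu).symm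
    rcases h2 with h2 | h2
    · exact Or.inl (aux X irreducible_X (by rwa [mul_comm]))
    · refine Or.inr (aux _ irreducible_X_add_one ?_)
      have h20 : (2 : F[X]) = 0 := by
        have := FiniteField.cast_card_eq_zero F
        rw [hF] at this
        have h4 := congrArg C this
        rwa [map_natCast, map_zero, Nat.cast_ofNat] at h4
      have : d * (X + 1) = X * d - d := by linear_combination d * h20
      rwa [this]

end TwoElements

/-! ### Ideal matrices and their exponentials. -/

section IdealMatrix

variable {R : Type*} [CommRing R]

open Classical in
/-- The circulant matrix of the indicator function of an ideal. -/
noncomputable def idealMatrix (I : Ideal R) : Matrix R R ℂ :=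
  Matrix.circulant fun r => if r ∈ I then 1 else 0

/-- A matrix which is, up to a phase, the permutation matrix of the translation by `a`. -/
def IsPhaseTranslation [DecidableEq R] (M : Matrix R R ℂ) (a : R) : Prop :=
  ∃ c : ℂ, ‖c‖ = 1 ∧ M = c • Matrix.circulant (Pi.single a 1)

theorem isPhaseTranslation_smul_one [DecidableEq R] {c : ℂ} (hc : ‖c‖ = 1) :
    IsPhaseTranslation (c • (1 : Matrix R R ℂ)) 0 :=
  ⟨c, hc, by rw [Matrix.circulant_single_one]⟩

variable [Fintype R]

theorem idealMatrix_mul_self (I : Ideal R) :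
    idealMatrix I * idealMatrix I = (Nat.card I : ℂ) • idealMatrix I := by
  classical
  ext u v
  have hcard : (Nat.card I : ℂ) = ∑ s : R, if s ∈ I then 1 else 0 := by
    rw [Finset.sum_boole, Nat.card_eq_fintype_card, Fintype.card_subtype]
  rw [hcard]
  unfold idealMatrix
  rw [Matrix.circulant_mul]
  simp only [Matrix.circulant_apply, Matrix.mulVec, dotProduct, Matrix.smul_apply, smul_eq_mul]
  rw [Finset.sum_mul]
  refine Finset.sum_congr rfl fun s _ => ?_
  by_cases hs : s ∈ I
  · simp [hs, I.sub_mem_iff_left hs]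
  · simp [hs]

theorem idealMatrix_commute (I J : Ideal R) : Commute (idealMatrix I) (idealMatrix J) :=
  Matrix.circulant_mul_comm _ _

variable [DecidableEq R]

theorem IsPhaseTranslation.mul {M N : Matrix R R ℂ} {a b : R} (hM : IsPhaseTranslation M a)
    (hN : IsPhaseTranslation N b) : IsPhaseTranslation (M * N) (a + b) := by
  obtain ⟨c, hc, rfl⟩ := hM
  obtain ⟨d, hd, rfl⟩ := hN
  refine ⟨c * d, by simp [hc, hd], ?_⟩
  rw [Matrix.smul_mul, Matrix.mul_smul, smul_smul, Matrix.circulant_mul]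
  congr 2
  ext r
  simp [Matrix.circulant_apply, Pi.single_apply, sub_eq_iff_eq_add]

theorem isPhaseTranslation_exp_of_card_eq_one {I : Ideal R} (hI : Nat.card I = 1) (t : ℝ) :
    IsPhaseTranslation (NormedSpace.exp ((Complex.I * (t : ℂ)) • idealMatrix I)) 0 := by
  have hI0 : idealMatrix I = 1 := by
    have : I = ⊥ := by
      rw [Submodule.eq_bot_iff]
      have := (Nat.card_eq_one_iff_unique.1 hI).1
      intro x hx
      exact congrArg Subtype.val (Subsingleton.elim (⟨x, hx⟩ : I) 0)
    subst this
    ext u v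
    simp [idealMatrix, Matrix.circulant_apply, Matrix.one_apply, sub_eq_zero]
  rw [hI0, Matrix.exp_smul_of_mul_self (m := 1) one_ne_zero (by simp)]
  convert isPhaseTranslation_smul_one (R := R) (Complex.norm_exp_ofReal_mul_I t) using 1
  rw [mul_one, div_one, sub_smul, one_smul, mul_comm]
  abel

/-- Here the exponential is `1 - N`, and `N` is 1 plus the translation by `a`, leaving minus that
translation. -/
theorem isPhaseTranslation_exp_of_card_eq_two {I : Ideal R} (hI : Nat.card I = 2) {a : R}
    (ha : a ∈ I) (ha0 : a ≠ 0) {z : ℂ} (hz : Complex.exp (z * 2) = -1) :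
    IsPhaseTranslation (NormedSpace.exp (z • idealMatrix I)) a := by
  classical
  have hmem : ∀ r, r ∈ I ↔ r = 0 ∨ r = a := by
    intro r
    constructor
    · intro hr
      by_contra! hcon
      have h1 : ({0, a, r} : Finset R) ⊆ Finset.univ.filter (· ∈ I) := by
        intro x
        simp only [Finset.mem_insert, Finset.mem_singleton, Finset.mem_filter, Finset.mem_univ,
          true_and]
        rintro (rfl | rfl | rfl)
        exacts [I.zero_mem, ha, hr]
      have h2 := Finset.card_le_card h1
      rw [← Fintype.card_subtype, ← Nat.card_eq_fintype_card,
        Finset.card_eq_three.2 ⟨0, a, r, ha0.symm, hcon.1.symm, hcon.2.symm, rfl⟩] at h2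
      change 3 ≤ Nat.card I at h2
      omega
    · rintro (rfl | rfl)
      exacts [I.zero_mem, ha]
  have hmul := idealMatrix_mul_self I
  rw [hI] at hmul
  rw [Matrix.exp_smul_of_mul_self (by simp) hmul, Nat.cast_ofNat, hz]
  refine ⟨-1, by simp, ?_⟩
  ext u v
  by_cases h : u = v
  · subst h
    simp [idealMatrix, Matrix.circulant_apply, ha0.symm]
    norm_num
  · have h' : u - v ≠ 0 := sub_ne_zero.2 h
    by_cases h2 : u - v = a
    · simp [idealMatrix, Matrix.circulant_apply, h, h2, ha]
      norm_num
    · simp [idealMatrix, Matrix.circulant_apply, h, h2, hmem, h']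

theorem isPhaseTranslation_exp_of_exp_card {I : Ideal R} {z : ℂ}
    (hz : Complex.exp (z * Nat.card I) = 1) :
    IsPhaseTranslation (NormedSpace.exp (z • idealMatrix I)) 0 := by
  rw [Matrix.exp_smul_of_mul_self (Nat.cast_ne_zero.2 Nat.card_pos.ne') (idealMatrix_mul_self I),
    hz]
  simpa using isPhaseTranslation_smul_one (R := R) (c := 1) (by simp)

theorem isPhaseTranslation_exp_sum {ι : Type*} (s : Finset ι) (I : ι → Ideal R) (z : ι → ℂ)
    (a : ι → R)
    (h : ∀ i ∈ s, IsPhaseTranslation (NormedSpace.exp (z i • idealMatrix (I i))) (a i)) :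
    IsPhaseTranslation (NormedSpace.exp (∑ i ∈ s, z i • idealMatrix (I i))) (∑ i ∈ s, a i) := by
  classical
  induction s using Finset.induction_on with
  | empty => simpa using isPhaseTranslation_smul_one (R := R) (c := 1) (by simp)
  | insert i s hi ih =>
    rw [Finset.sum_insert hi, Finset.sum_insert hi, Matrix.exp_add_of_commute]
    · exact (h i (by simp)).mul (ih fun j hj => h j (by simp [hj]))
    · exact Commute.sum_right _ _ _ fun j _ =>
        ((idealMatrix_commute _ _).smul_left _).smul_right _

theorem hasPST_of_isPhaseTranslation {G : SimpleGraph R} {t : ℝ} (ht : 0 < t) {a : R} (ha : a ≠ 0)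
    (h : IsPhaseTranslation (quantumWalk G t) a) : HasPST G := by
  obtain ⟨c, hc, h⟩ := h
  exact ⟨a, 0, ha, t, ht, by simp [h, hc]⟩

end IdealMatrix

/-- Multiplication by `d` identifies `F[X] / (e)` with the ideal generated by `d` modulo `d * e`. -/
theorem natCard_span_mk {F : Type*} [Field F] [Fintype F] {d e : F[X]} (hd : d ≠ 0)
    (he : e ≠ 0) :
    Nat.card (Ideal.span {Ideal.Quotient.mk (Ideal.span {d * e}) d}) =
      Fintype.card F ^ e.natDegree := by
  set π := Ideal.Quotient.mk (Ideal.span {d * e}) with hπ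
  set φ := LinearMap.toSpanSingleton F[X] (F[X] ⧸ Ideal.span {d * e}) (π d) with hφ
  have happ : ∀ r, φ r = π (r * d) := fun r => rfl
  have hker : LinearMap.ker φ = Ideal.span {e} := by
    ext r
    rw [LinearMap.mem_ker, happ, mk_eq_zero_iff_dvd, Ideal.mem_span_singleton, mul_comm r d,
      mul_dvd_mul_iff_left hd]
  have hmem : ∀ x, x ∈ LinearMap.range φ ↔ x ∈ Ideal.span {π d} := by
    intro x
    rw [Ideal.mem_span_singleton', LinearMap.mem_range]
    constructor
    · rintro ⟨r, rfl⟩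
      exact ⟨π r, by rw [happ, map_mul]⟩
    · rintro ⟨s, rfl⟩
      obtain ⟨r, rfl⟩ := Ideal.Quotient.mk_surjective s
      exact ⟨r, by rw [happ, map_mul]⟩
  rw [← Nat.card_congr (Equiv.subtypeEquivRight hmem),
    ← Nat.card_congr φ.quotKerEquivRange.toEquiv, hker, ← finrank_quotient_span_eq_natDegree,
    ← Nat.card_eq_fintype_card]
  have : Module.Finite F (F[X] ⧸ Ideal.span {e}) :=
    Module.Finite.of_basis (AdjoinRoot.powerBasis he).basis
  exact Module.natCard_eq_pow_finrank

/-! ### Möbius expansion of the adjacency matrix. -/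

section Sufficiency

open UniqueFactorizationMonoid

variable {F : Type*} [Field F] [DecidableEq F]

theorem prod_dvd_iff_forall_dvd {f r : F[X]} {T : Finset F[X]} (hT : T ⊆ primeFactors f) :
    ∏ p ∈ T, p ∣ r ↔ ∀ p ∈ T, p ∣ r := by
  refine ⟨fun h p hp => (Finset.dvd_prod_of_mem _ hp).trans h, fun h => ?_⟩
  refine Finset.prod_dvd_of_isRelPrime (fun p hp q hq hpq => ?_) h
  exact pairwise_primeFactors_isRelPrime (hT hp) (hT hq) hpq

theorem prod_dvd_self_of_subset_primeFactors {f : F[X]} {T : Finset F[X]}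
    (hT : T ⊆ primeFactors f) : ∏ p ∈ T, p ∣ f :=
  (Finset.prod_dvd_prod_of_subset _ _ _ hT).trans radical_dvd_self

theorem isCoprime_iff_forall_primeFactors {f r : F[X]} (hf : f ≠ 0) :
    IsCoprime r f ↔ ∀ p ∈ primeFactors f, ¬ p ∣ r := by
  constructor
  · intro h p hp hpr
    rw [mem_primeFactors] at hp
    exact (irreducible_of_normalized_factor p hp).not_isUnit
      (h.isUnit_of_dvd' hpr (dvd_of_mem_normalizedFactors hp))
  · intro h
    refine isCoprime_of_prime_dvd (fun h0 => hf h0.2) fun p hp hpr hpf => ?_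
    obtain ⟨q, hq, hpq⟩ := exists_mem_normalizedFactors_of_dvd hf hp.irreducible hpf
    exact h q (mem_primeFactors.2 hq) (hpq.symm.dvd.trans hpr)

/-- Expand the product of `1 - [p ∣ r]` over the prime factors `p` of `f`. -/
theorem sum_powerset_primeFactors {f : F[X]} (hf : f ≠ 0) (r : F[X]) [Decidable (IsCoprime r f)]
    [∀ p : F[X], Decidable (p ∣ r)] :
    ∑ T ∈ (primeFactors f).powerset, (-1 : ℂ) ^ T.card * (if ∏ p ∈ T, p ∣ r then 1 else 0) =
      if IsCoprime r f then 1 else 0 := by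
  classical
  have h1 : ∀ T ∈ (primeFactors f).powerset,
      (-1 : ℂ) ^ T.card * (if ∏ p ∈ T, p ∣ r then 1 else 0) =
      (∏ p ∈ T, -(if p ∣ r then (1 : ℂ) else 0)) * ∏ p ∈ primeFactors f \ T, 1 := by
    intro T hT
    rw [Finset.prod_neg, Finset.prod_const_one, mul_one]
    congr 1
    simp only [prod_dvd_iff_forall_dvd (Finset.mem_powerset.1 hT)]
    rw [Finset.prod_boole]
  rw [Finset.sum_congr rfl h1, ← Finset.prod_add]
  simp only [isCoprime_iff_forall_primeFactors hf]
  split_ifs with h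
  · exact Finset.prod_eq_one fun p hp => by simp [h p hp]
  · push Not at h
    obtain ⟨p, hp, hpr⟩ := h
    exact Finset.prod_eq_zero hp (by simp [hpr])

theorem adjMatrix_unitaryCayleyGraph_quotient {f : F[X]} (hf : f ≠ 0) (hu : ¬ IsUnit f)
    [DecidableRel (unitaryCayleyGraph (F[X] ⧸ Ideal.span {f})).Adj] :
    (unitaryCayleyGraph (F[X] ⧸ Ideal.span {f})).adjMatrix ℂ =
      ∑ T ∈ (primeFactors f).powerset, (-1 : ℂ) ^ T.card •
        idealMatrix (Ideal.span {Ideal.Quotient.mk (Ideal.span {f}) (∏ p ∈ T, p)}) := by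
  classical
  have : Nontrivial (F[X] ⧸ Ideal.span {f}) :=
    Ideal.Quotient.nontrivial_iff.2 (by rwa [Ne, Ideal.span_singleton_eq_top])
  ext u v
  obtain ⟨r, hr⟩ := Ideal.Quotient.mk_surjective (u - v)
  rw [SimpleGraph.adjMatrix_apply, Matrix.sum_apply]
  simp only [unitaryCayleyGraph_adj, ← hr, isUnit_mk_iff_isCoprime]
  rw [← sum_powerset_primeFactors hf r]
  refine Finset.sum_congr rfl fun T hT => ?_
  simp only [idealMatrix, Matrix.smul_apply, Matrix.circulant_apply, ← hr, smul_eq_mul,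
    mk_mem_span_mk_iff_dvd (prod_dvd_self_of_subset_primeFactors (Finset.mem_powerset.1 hT))]

end Sufficiency

/-! ### The walk at time `π / 2`. -/

section PerfectStateTransfer

open UniqueFactorizationMonoid

variable {F : Type*} [Field F]

/-- Every summand has degree below that of `f`, so divisibility would force the sum to be zero. At
most two summands occur, `f / X` and `f / (X + 1)`; if both do, a vanishing sum gives `d * (2 * X +
1) = 0`. -/
theorem not_dvd_sum_of_mul_linear {f : F[X]} {D : Finset F[X]} (hf : f ≠ 0)
    (hD : ∀ d ∈ D, d * X = f ∨ d * (X + 1) = f) (h0 : D.Nonempty) :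
    ¬ f ∣ ∑ d ∈ D, d := by
  classical
  have hdeg : ∀ d ∈ D, d.degree < f.degree := by
    have hlin : (X + 1 : F[X]).degree = 1 := by simpa using degree_X_add_C (1 : F)
    have hd0 : ∀ d l : F[X], d * l = f → l.degree = 1 → d.degree < f.degree := by
      rintro d l rfl hl
      have hd : d ≠ 0 := left_ne_zero_of_mul hf
      have hl0 : l ≠ 0 := right_ne_zero_of_mul hf
      rw [degree_eq_natDegree hd, degree_eq_natDegree hf, natDegree_mul hd hl0,
        natDegree_eq_of_degree_eq_some hl]
      exact_mod_cast Nat.lt_succ_self _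
    intro d hd
    rcases hD d hd with h | h
    · exact hd0 d X h degree_X
    · exact hd0 d _ h hlin
  have hX1 : (X + 1 : F[X]) ≠ 0 := irreducible_X_add_one.ne_zero
  intro hdvd
  have hsum : ∑ d ∈ D, d = 0 := by
    refine eq_zero_of_dvd_of_degree_lt hdvd ?_
    refine (degree_sum_le _ _).trans_lt ?_
    rw [Finset.sup_lt_iff (bot_lt_iff_ne_bot.2 (degree_ne_bot.2 hf))]
    exact hdeg
  have hinj : ∀ l d d' : F[X], l ≠ 0 → d * l = f → d' * l = f → d = d' := fun l d d' hl h h' =>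
    mul_right_cancel₀ hl (h.trans h'.symm)
  by_cases hone : ∃ d, D = {d}
  · obtain ⟨d, rfl⟩ := hone
    rw [Finset.sum_singleton] at hsum
    rcases hD d (by simp) with h | h <;> exact hf (by rw [← h, hsum, zero_mul])
  · have hex : ∃ d ∈ D, ∃ d' ∈ D, d ≠ d' := by
      by_contra! hcon
      obtain ⟨d, hd⟩ := h0
      exact hone ⟨d, Finset.eq_singleton_iff_unique_mem.2 ⟨hd, fun x hx => hcon x hx d hd⟩⟩
    have hex2 : ∃ d ∈ D, ∃ d' ∈ D, d * X = f ∧ d' * (X + 1) = f := by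
      obtain ⟨d, hd, d', hd', hne⟩ := hex
      rcases hD d hd with h | h <;> rcases hD d' hd' with h' | h'
      · exact absurd (hinj _ _ _ X_ne_zero h h') hne
      · exact ⟨d, hd, d', hd', h, h'⟩
      · exact ⟨d', hd', d, hd, h', h⟩
      · exact absurd (hinj _ _ _ hX1 h h') hne
    obtain ⟨d, hd, d', hd', h, h'⟩ := hex2
    have hne : d ≠ d' := by
      rintro rfl
      have h1 : d = 0 := by linear_combination h' - h
      exact hf (by rw [← h, h1, zero_mul])
    have hDeq : D = {d, d'} := by
      ext x
      simp only [Finset.mem_insert, Finset.mem_singleton]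
      constructor
      · intro hx
        rcases hD x hx with hx | hx
        · exact Or.inl (hinj _ _ _ X_ne_zero hx h)
        · exact Or.inr (hinj _ _ _ hX1 hx h')
      · rintro (rfl | rfl)
        exacts [hd, hd']
    rw [hDeq, Finset.sum_pair hne] at hsum
    have h2 : d * (2 * X + 1) = 0 := by linear_combination h - h' + (X + 1) * hsum
    rcases mul_eq_zero.1 h2 with h3 | h3
    · exact hf (by rw [← h, h3, zero_mul])
    · simpa using congrArg (eval 0) h3

theorem prod_injOn_powerset_primeFactors [DecidableEq F] (f : F[X]) :
    Set.InjOn (fun T : Finset F[X] => ∏ p ∈ T, p) ((primeFactors f).powerset : Set _) := by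
  have key : ∀ T ∈ (primeFactors f).powerset, ∀ T' ∈ (primeFactors f).powerset,
      ∏ p ∈ T, p = ∏ p ∈ T', p → T ⊆ T' := by
    intro T hT T' hT' h p hp
    rw [Finset.mem_powerset] at hT hT'
    have hpp := mem_primeFactors.1 (hT hp)
    have hdvd : p ∣ ∏ p ∈ T', p := h ▸ Finset.dvd_prod_of_mem _ hp
    obtain ⟨q, hq, hpq⟩ := ((prime_of_normalized_factor p hpp).dvd_finsetProd_iff _).1 hdvd
    have hqq := mem_primeFactors.1 (hT' hq)
    have : p = q := by
      rw [← normalize_normalized_factor p hpp, ← normalize_normalized_factor q hqq]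
      exact normalize_eq_normalize_iff_associated.2
        ((irreducible_of_normalized_factor p hpp).associated_of_dvd
          (irreducible_of_normalized_factor q hqq) hpq)
    rwa [this]
  intro T hT T' hT' h
  exact (key T hT T' hT' h).antisymm (key T' hT' T hT h.symm)

theorem hasPST_of_eq_squarefree_mul [Fintype F] (hF : Fintype.card F = 2) {f : F[X]} (hf : f ≠ 0)
    [Fintype (F[X] ⧸ Ideal.span {f})]
    (h : ∃ d e : F[X], Squarefree d ∧ f = d * e ∧ (e = X ∨ e = X + 1)) :
    HasPST (unitaryCayleyGraph (F[X] ⧸ Ideal.span {f})) := by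
  classical
  set π := Ideal.Quotient.mk (Ideal.span {f}) with hπ
  set P := (primeFactors f).powerset with hP
  set D := P.filter fun T => ∃ e : F[X], f = (∏ p ∈ T, p) * e ∧ e.natDegree = 1 with hD
  have hXdeg : (X + 1 : F[X]).natDegree = 1 := by simpa using natDegree_X_add_C (1 : F)
  have hu : ¬ IsUnit f := by
    obtain ⟨d, e, -, rfl, rfl | rfl⟩ := h
    · exact fun hu => irreducible_X.not_isUnit (isUnit_of_mul_isUnit_right hu)
    · exact fun hu => irreducible_X_add_one.not_isUnit (isUnit_of_mul_isUnit_right hu)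
  have hne : D.Nonempty := by
    obtain ⟨d, e, hd, hfe, he⟩ := h
    have hd0 : d ≠ 0 := hd.ne_zero
    have he0 : e ≠ 0 := by rintro rfl; simp at hfe; exact hf hfe
    refine ⟨primeFactors d, Finset.mem_filter.2 ⟨Finset.mem_powerset.2 ?_, e, ?_, ?_⟩⟩
    · rw [hfe, primeFactors_mul_eq_union hd0 he0]
      exact Finset.subset_union_left
    · have := eq_of_associated_of_card_eq_two hF (radical_associated hd.isRadical hd0)
      rw [UniqueFactorizationMonoid.radical] at this
      simp only [id] at this
      rw [this]
      exact hfe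
    · rcases he with rfl | rfl
      exacts [natDegree_X, hXdeg]
  have hne0 : ∑ T ∈ P, (if T ∈ D then π (∏ p ∈ T, p) else 0) ≠ 0 := by
    rw [← Finset.sum_filter, Finset.filter_mem_eq_inter,
      Finset.inter_eq_right.2 (Finset.filter_subset _ _), ← map_sum, Ne, hπ, mk_eq_zero_iff_dvd,
      ← Finset.sum_image (f := fun d => d) (g := fun T : Finset F[X] => ∏ p ∈ T, p)
        ((prod_injOn_powerset_primeFactors f).mono
          (Finset.coe_subset.2 (Finset.filter_subset _ _)))]
    refine not_dvd_sum_of_mul_linear hf ?_ (hne.image _)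
    intro d hd
    obtain ⟨T, hT, rfl⟩ := Finset.mem_image.1 hd
    obtain ⟨e, he, hdeg⟩ := (Finset.mem_filter.1 hT).2
    rcases eq_X_or_eq_X_add_one hF hdeg with rfl | rfl
    exacts [Or.inl he.symm, Or.inr he.symm]
  refine hasPST_of_isPhaseTranslation (t := Real.pi / 2) (by positivity) hne0 ?_
  rw [quantumWalk_eq_exp, adjMatrix_unitaryCayleyGraph_quotient hf hu, Finset.smul_sum]
  simp only [smul_smul]
  refine isPhaseTranslation_exp_sum _ _ _ _ fun T hT => ?_
  obtain ⟨e, he⟩ := prod_dvd_self_of_subset_primeFactors (Finset.mem_powerset.1 hT)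
  have hd0 : ∏ p ∈ T, p ≠ 0 := by intro h0; rw [h0, zero_mul] at he; exact hf he
  have he0 : e ≠ 0 := by rintro rfl; rw [mul_zero] at he; exact hf he
  have hcard : Nat.card (Ideal.span {π (∏ p ∈ T, p)}) = 2 ^ e.natDegree := by
    have := natCard_span_mk hd0 he0
    rw [hF, ← he] at this
    exact this
  -- Only the oddness of the sign matters for the phases below.
  obtain ⟨s, hs⟩ : ∃ s : ℤ, (-1 : ℂ) ^ T.card = (2 * s + 1 : ℤ) := by
    rcases neg_one_pow_eq_or ℂ T.card with h1 | h1
    · exact ⟨0, by rw [h1]; simp⟩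
    · exact ⟨-1, by rw [h1]; norm_num⟩
  have hTD : T ∈ D ↔ e.natDegree = 1 := by
    rw [hD, Finset.mem_filter]
    refine ⟨fun hx => ?_, fun hx => ⟨hT, e, he, hx⟩⟩
    obtain ⟨-, e', he', hdeg⟩ := hx
    rwa [mul_left_cancel₀ hd0 (he.symm.trans he')]
  rcases Nat.lt_trichotomy e.natDegree 1 with hlt | heq | hgt
  · rw [if_neg (fun hx => hlt.ne (hTD.1 hx))]
    have h0 : e.natDegree = 0 := by omega
    rw [h0, pow_zero] at hcard
    have := isPhaseTranslation_exp_of_card_eq_one hcard (Real.pi / 2 * (2 * s + 1))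
    have hz : Complex.I * ((Real.pi / 2 : ℝ) : ℂ) * (-1) ^ T.card =
        Complex.I * ((Real.pi / 2 * (2 * s + 1) : ℝ) : ℂ) := by
      rw [hs]
      push_cast
      ring
    rw [hz]
    exact this
  · rw [if_pos (hTD.2 heq)]
    rw [heq, pow_one] at hcard
    refine isPhaseTranslation_exp_of_card_eq_two hcard (Ideal.mem_span_singleton_self _) ?_ ?_
    · rw [hπ, Ne, mk_eq_zero_iff_dvd]
      intro hdvd
      have h1 := natDegree_le_of_dvd hdvd hd0
      rw [he, natDegree_mul hd0 he0, heq] at h1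
      omega
    · rw [hs]
      have : Complex.I * ((Real.pi / 2 : ℝ) : ℂ) * ((2 * s + 1 : ℤ) : ℂ) * 2 =
          Real.pi * Complex.I + s * (2 * Real.pi * Complex.I) := by
        push_cast
        ring
      rw [this, Complex.exp_add, Complex.exp_int_mul_two_pi_mul_I, Complex.exp_pi_mul_I, mul_one]
  · rw [if_neg (fun hx => hgt.ne' (hTD.1 hx))]
    apply isPhaseTranslation_exp_of_exp_card
    -- Now 4 divides `|I|`, so `± π / 2 * |I|` is a multiple of `2 * π`.
    obtain ⟨k, hk⟩ : ∃ k, e.natDegree = k + 2 := ⟨e.natDegree - 2, by omega⟩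
    rw [hcard, hk, hs]
    have : Complex.I * ((Real.pi / 2 : ℝ) : ℂ) * ((2 * s + 1 : ℤ) : ℂ) * ((2 ^ (k + 2) : ℕ) : ℂ) =
        ((2 ^ k * (2 * s + 1) : ℤ) : ℂ) * (2 * Real.pi * Complex.I) := by
      push_cast
      ring
    rw [this, Complex.exp_int_mul_two_pi_mul_I]

end PerfectStateTransfer

theorem mainTheorem6 {F : Type*} [Field F] [Fintype F] (f : F[X]) (hf : f.Monic) :
    @HasPST _ (fintypeQuotientOfMonic hf) (unitaryCayleyGraph (F[X] ⧸ Ideal.span {f})) ↔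
      Fintype.card F = 2 ∧
        ∃ (a b : ℕ) (g : F[X]), f = X ^ a * (X + 1) ^ b * g ∧
          Squarefree g ∧ IsCoprime g (X * (X + 1)) ∧
          1 ≤ max a b ∧ max a b ≤ 2 ∧ (a, b) ≠ (2, 2) := by
  let _ := fintypeQuotientOfMonic hf
  rw [← exists_squarefree_mul_iff]
  constructor
  · rintro ⟨a, b, hab, t, -, h⟩
    exact ⟨card_eq_two_of_norm_quantumWalk hab h,
      exists_squarefree_mul_of_norm_quantumWalk hf.ne_zero hab h⟩
  · rintro ⟨hF, h⟩
    exact hasPST_of_eq_squarefree_mul hF hf.ne_zero h
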